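/- Theorem. Let $G=(V,E)$ be a connected, countable, locally finite graph (undirected, without loops or multiple edges) that is transitive, i.e., for all $x,y\in V$ some automorphism of $G$ maps $x$ to $y$. Fix a vertex $o\in V$, and for $n\ge 1$ let $a_n(G)$ be the number of simple cycles of length $n$ in $G$ that contain $o$; here a simple cycle is a cycle that does not use any vertex or edge more than once, and cycles that differ only in starting point or direction are identified. In Bernoulli($p$) bond (respectively site) percolation on $G$, each edge (respectively vertex) is open with probability $p$, independently; the clusters are the connected components of the subgraph formed by all vertices and the open edges (respectively of the subgraph induced by the open vertices). Let $$p_u(G):=\inf\{p\in[0,1] : \text{there is a.s. a unique infinite cluster in Bernoulli}(p)\text{ percolation on }G\}$$ (with $\inf\emptyset=\infty$, which occurs only if $G$ is finite). Then, both for bond percolation and for site percolation, $$p_u(G)\ \ge\ \min\Bigl\{1,\ \liminf_{n\to\infty} a_n(G)^{-1/n}\Bigr\},$$ where $a_n(G)^{-1/n}:=\infty$ if $a_n(G)=0$. In other words, $p_u(G)\ge \liminf_{n\to\infty} a_n(G)^{-1/n}$ if $a_n(G)\ne 0$ for infinitely many $n$ (the $\liminf$ is then at most $1$), and $p_u(G)\ge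 1$ otherwise. -/

import Mathlib

open MeasureTheory ProbabilityTheory Filter
open scoped ENNReal unitInterval

namespace Percolation

variable {V : Type*}

/-- `G` is transitive: its automorphism group has only one orbit of vertices. -/
def IsTransitive (G : SimpleGraph V) : Prop :=
  ∀ x y : V, ∃ φ : G ≃g G, φ x = y

/-- `H` has exactly one infinite cluster (connected component). -/
def HasUniqueInfiniteCluster {W : Type*} (H : SimpleGraph W) : Prop :=
  ∃! C : H.ConnectedComponent, C.supp.Infinite

/-- The percolation subgraph of bond percolation: all vertices, and the open edges `ω`. -/
def bondSubgraph (G : SimpleGraph V) (ω : Set G.edgeSet) : SimpleGraph V :=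
  SimpleGraph.fromEdgeSet (Subtype.val '' ω)

/-- The percolation subgraph of site percolation: the open vertices `ω`, and all edges of `G`
between them. -/
def siteSubgraph (G : SimpleGraph V) (ω : Set V) : SimpleGraph ω :=
  G.induce ω

/-- The law of Bernoulli(`p`) bond percolation: each edge is open with probability `p`,
independently. -/
noncomputable def bondMeasure (G : SimpleGraph V) (p : I) : Measure (Set G.edgeSet) :=
  setBernoulli Set.univ p

/-- The law of Bernoulli(`p`) site percolation: each vertex is open with probability `p`,
independently. -/
noncomputable def siteMeasure (_G : SimpleGraph V) (p : I) : Measure (Set V) :=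
  setBernoulli Set.univ p

/-- The uniqueness threshold of bond percolation: the infimum of all `p ∈ [0, 1]` for which there is
almost surely a unique infinite cluster (with `inf ∅ = ∞`, which matters for finite graphs only). -/
noncomputable def puBond (G : SimpleGraph V) : ℝ≥0∞ :=
  ⨅ (p : I) (_ : ∀ᵐ ω ∂(bondMeasure G p), HasUniqueInfiniteCluster (bondSubgraph G ω)),
    ENNReal.ofReal p

/-- The uniqueness threshold of site percolation. -/
noncomputable def puSite (G : SimpleGraph V) : ℝ≥0∞ :=
  ⨅ (p : I) (_ : ∀ᵐ ω ∂(siteMeasure G p), HasUniqueInfiniteCluster (siteSubgraph G ω)),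
    ENNReal.ofReal p

/-- The simple cycles of length `n` in `G` that contain `o`, as subgraphs of `G` (so that neither
the starting vertex nor the direction in which a cycle is run through matters). -/
def simpleCycles (G : SimpleGraph V) (o : V) (n : ℕ) : Set G.Subgraph :=
  {C | o ∈ C.verts ∧ ∃ (v : V) (w : G.Walk v v), w.IsCycle ∧ w.length = n ∧ w.toSubgraph = C}

/-- `a_n(G)`, the number of simple cycles of length `n` in `G` that contain `o`. -/
noncomputable def numSimpleCycles (G : SimpleGraph V) (o : V) (n : ℕ) : ℕ∞ :=
  (simpleCycles G o n).encard

/-- `liminf_n a_n(G)^{-1/n}` in `[0, ∞]`, where `a_n(G)^{-1/n} = ∞` if `a_n(G) = 0` and `n ≥ 1`. -/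
noncomputable def cycleLiminf (G : SimpleGraph V) (o : V) : ℝ≥0∞ :=
  liminf (fun n : ℕ ↦ (numSimpleCycles G o n : ℝ≥0∞) ^ (-(1 / (n : ℝ)))) atTop

end Percolation

/-!
Let `p < 1` be a density with almost surely exactly one infinite cluster, and suppose
`p < liminf a_n ^ (-1 / n)`. Fix a density `p'` strictly between `p` and the liminf (and below `1`).
Two facts contradict each other; neither uses correlation inequalities, finite modifications of
configurations, or monotonicity of uniqueness in `p`.

*The two-point function at `p` does not vanish at infinity*
(`Model.exists_infinite_lt_setBernoulli_reachable`). By transitivity every vertex belongs to the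
infinite cluster with the same probability `θ > 0`. By uniqueness, two vertices of infinite clusters
are connected. If the two-point function vanished at infinity, one could find arbitrarily many
vertices for which these events of probability `θ` are almost disjoint.

*The two-point function at `p` vanishes at infinity* (`Model.finite_lt_setBernoulli_reachable`).
The expected number of open cycles of length `n` through a vertex is at most `a_n * p' ^ n`, which
decays exponentially, so at density `p'` long open cycles near a fixed vertex are unlikely
(`Model.exists_setBernoulli_long_cycle_le`). A graph without long cycles near `x` has a cut vertex
separating `x` from any far vertex (`Reachable.exists_separating_annulus`): an open path to a far
vertex leaves a ball around `x` at some vertex `v`, and the last vertex of the path that lies on a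
common cycle with `v` is a cut vertex, since a detour around it would be an ear producing a cycle
through `v` and a still later vertex. Applied in many annuli, this yields many cut vertices between
`x` and any sufficiently far `y` with high probability. The configuration at density `p` is an
independent thinning of the one at density `p'` (`map_inter_setBernoulli_prod`), and for each cut
vertex the thinning closes everything at that vertex with probability bounded below, independently
for vertices at distance at least `2`. Hence `x` and `y` are unlikely to be connected at density
`p`.

Bond and site percolation are handled together through the structure `Model`, which records, for
each edge, the random elements that have to be open for the edge to be usable.
-/

/-! ### Cut vertices in graphs without long cycles -/

namespace SimpleGraph

variable {V : Type*}

/-- A walk that visits a set `S` splits at its last visit to `S`. -/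
lemma Walk.exists_append_last_visit {H : SimpleGraph V} {x y : V} (P : H.Walk x y) (S : Set V)
    (hS : ∃ z ∈ P.support, z ∈ S) :
    ∃ (z : V) (P₁ : H.Walk x z) (P₂ : H.Walk z y), P = P₁.append P₂ ∧ z ∈ S ∧
      ∀ w ∈ P₂.support.tail, w ∉ S := by
  induction P with
  | nil =>
    obtain ⟨z, hz, hzS⟩ := hS
    obtain rfl : z = _ := by simpa using hz
    exact ⟨z, .nil, .nil, rfl, hzS, by simp⟩
  | @cons a b c h p ih =>
    by_cases hp : ∃ z ∈ p.support, z ∈ S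
    · obtain ⟨z, P₁, P₂, rfl, hz, h₂⟩ := ih hp
      exact ⟨z, .cons h P₁, P₂, rfl, hz, h₂⟩
    · push Not at hp
      obtain ⟨z, hz, hzS⟩ := hS
      rcases List.mem_cons.1 (by simpa using hz) with rfl | hz'
      · exact ⟨z, .nil, .cons h p, rfl, hzS, by simpa using hp⟩
      · exact absurd hzS (hp z hz')

/-- The concatenation of two paths that meet only at the junction is a path. -/
lemma Walk.IsPath.append_of_inter {H : SimpleGraph V} {x y z : V} {p : H.Walk x y}
    {q : H.Walk y z} (hp : p.IsPath) (hq : q.IsPath)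
    (h : ∀ w ∈ p.support, w ∈ q.support → w = y) : (p.append q).IsPath := by
  rw [Walk.isPath_def, Walk.support_append, List.nodup_append']
  refine ⟨hp.support_nodup, hq.support_nodup.tail, fun w hw hw' ↦ ?_⟩
  have hwy := h w hw (List.mem_of_mem_tail hw')
  have := hq.support_nodup
  rw [← q.cons_tail_support] at this
  exact (List.nodup_cons.1 this).1 (hwy ▸ hw')

/-- A walk between two sets `A` and `B` visits the vertices of some path that meets `A` only in its
first vertex and `B` only in its last vertex. -/
lemma Walk.exists_isPath_inter {H : SimpleGraph V} {a b : V} (Q : H.Walk a b) {A B : Set V}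
    (ha : a ∈ A) (hb : b ∈ B) :
    ∃ (u t : V) (R : H.Walk u t), R.IsPath ∧ R.support ⊆ Q.support ∧ u ∈ A ∧ t ∈ B ∧
      (∀ w ∈ R.support, w ∈ A → w = u) ∧ ∀ w ∈ R.support, w ∈ B → w = t := by
  classical
  let M : Set ℕ := {n | ∃ (u t : V) (R : H.Walk u t), R.support ⊆ Q.support ∧ u ∈ A ∧ t ∈ B ∧
    R.length = n}
  have hM : M.Nonempty := ⟨_, a, b, Q, fun _ h ↦ h, ha, hb, rfl⟩
  obtain ⟨u, t, R, hR, hu, ht, hn⟩ := Nat.sInf_mem hM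
  have hmin : ∀ (u' t' : V) (R' : H.Walk u' t'), R'.support ⊆ Q.support → u' ∈ A → t' ∈ B →
      R.length ≤ R'.length := fun u' t' R' h1 h2 h3 ↦
    hn ▸ Nat.sInf_le ⟨u', t', R', h1, h2, h3, rfl⟩
  refine ⟨u, t, R, ?_, hR, hu, ht, fun w hw hwA ↦ ?_, fun w hw hwB ↦ ?_⟩
  · have h1 := hmin _ _ R.bypass (fun w hw ↦ hR (R.support_bypass_subset_support hw)) hu ht
    have h2 : R.bypass = R := R.bypass_eq_self_of_length_le_length_bypass h1
    rw [← h2]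
    exact R.bypass_isPath
  · by_contra hne
    have h1 := hmin _ _ (R.dropUntil w hw)
      (fun z hz ↦ hR (R.support_dropUntil_subset_support hw hz)) hwA ht
    have h2 := R.length_dropUntil_lt_length hw hne
    omega
  · by_contra hne
    have h1 := hmin _ _ (R.takeUntil w hw)
      (fun z hz ↦ hR (R.support_takeUntil_subset_support hw hz)) hu hwB
    have h2 := R.length_takeUntil_lt_length hw hne
    omega

/-- Two vertices are doubly joined if there are two paths between them without a common interior
vertex. The two paths may coincide, so that adjacent vertices are doubly joined; doubly joined
vertices that are distinct and not adjacent lie on a common simple cycle. -/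
def DoublyJoined (H : SimpleGraph V) (v z : V) : Prop :=
  ∃ p₁ p₂ : H.Walk v z, p₁.IsPath ∧ p₂.IsPath ∧
    ∀ w ∈ p₁.support, w ∈ p₂.support → w = v ∨ w = z

lemma Adj.doublyJoined {H : SimpleGraph V} {v z : V} (h : H.Adj v z) : H.DoublyJoined v z :=
  ⟨h.toWalk, h.toWalk, .of_adj h, .of_adj h, by simp⟩

lemma doublyJoined_of_mem_support {H : SimpleGraph V} {v z w : V} {p₁ p₂ : H.Walk v z}
    (h₁ : p₁.IsPath) (h₂ : p₂.IsPath) (h : ∀ w ∈ p₁.support, w ∈ p₂.support → w = v ∨ w = z)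
    (hw : w ∈ p₁.support) (hwv : w ≠ v) : H.DoublyJoined v w := by
  classical
  rcases eq_or_ne w z with rfl | hwz
  · exact ⟨p₁, p₂, h₁, h₂, h⟩
  have hsplit : ((p₁.takeUntil w hw).append (p₁.dropUntil w hw)).IsPath := by
    rwa [Walk.take_spec]
  have hvd : v ∉ (p₁.dropUntil w hw).support := fun hv ↦
    hsplit.ne_of_mem_support_of_append hwv.symm (Walk.start_mem_support _) hv rfl
  refine ⟨p₁.takeUntil w hw, p₂.append (p₁.dropUntil w hw).reverse, h₁.takeUntil hw,
    h₂.append_of_inter (h₁.dropUntil hw).reverse fun a ha ha' ↦ ?_, fun a ha ha' ↦ ?_⟩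
  · rw [Walk.support_reverse, List.mem_reverse] at ha'
    rcases h a (p₁.support_dropUntil_subset_support hw ha') ha with rfl | rfl
    · exact absurd ha' hvd
    · rfl
  · rw [Walk.mem_support_append_iff, Walk.support_reverse, List.mem_reverse] at ha'
    rcases ha' with ha' | ha'
    · rcases h a (p₁.support_takeUntil_subset_support hw ha) ha' with rfl | rfl
      · exact .inl rfl
      · exact absurd ha (Walk.endpoint_notMem_support_takeUntil h₁ hw hwz.symm)
    · right
      by_contra haw
      exact hsplit.ne_of_mem_support_of_append haw ha ha' rfl

/-- If every cycle through `v` has length at most `L`, the vertices doubly joined to `v` are within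
distance `L` of `v`, also in the metric of a larger graph. -/
lemma DoublyJoined.dist_le {G H : SimpleGraph V} (hHG : H ≤ G) {v z : V} {L : ℕ} (hL : 1 ≤ L)
    (hcyc : ∀ w : H.Walk v v, w.IsCycle → w.length ≤ L) (h : H.DoublyJoined v z) :
    G.dist v z ≤ L := by
  obtain ⟨p₁, p₂, h₁, h₂, h⟩ := h
  have hd₁ : G.dist v z ≤ p₁.length := by simpa using SimpleGraph.dist_le (p₁.mapLe hHG)
  have hd₂ : G.dist v z ≤ p₂.length := by simpa using SimpleGraph.dist_le (p₂.mapLe hHG)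
  by_contra! hlt
  have hc : (p₁.append p₂.reverse).IsCycle := by
    refine h₁.isCycle_append h₂.reverse (fun w hw hw' ↦ ?_) (.inl (by omega))
    have n₁ := h₁.support_nodup
    have n₂ := h₂.reverse.support_nodup
    rw [← Walk.cons_tail_support] at n₁ n₂
    have m₁ := List.mem_of_mem_tail hw
    have m₂ := List.mem_of_mem_tail hw'
    rw [Walk.support_reverse, List.mem_reverse] at m₂
    rcases h w m₁ m₂ with rfl | rfl
    · exact (List.nodup_cons.1 n₁).1 hw
    · exact (List.nodup_cons.1 n₂).1 hw'
  have := hcyc _ hc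
  simp only [Walk.length_append, Walk.length_reverse] at this
  omega

/-- A path `P` from `v` leaves the neighbourhood of `v` through a cut vertex: the last vertex of `P`
that is doubly joined to `v` lies on every walk from `v` to the end of `P`. -/
lemma Walk.IsPath.exists_doublyJoined_separating {H : SimpleGraph V} {v y : V} {P : H.Walk v y}
    (hP : P.IsPath) (hvy : v ≠ y) :
    ∃ c ∈ P.support, c ≠ v ∧ H.DoublyJoined v c ∧ ∀ Q : H.Walk v y, c ∈ Q.support := by
  classical
  have hex : ∃ z ∈ P.support, z ∈ {z | z ≠ v ∧ H.DoublyJoined v z} := by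
    cases P with
    | nil => exact absurd rfl hvy
    | cons h p => exact ⟨_, by simp, h.ne.symm, h.doublyJoined⟩
  obtain ⟨c, P₁, P₂, rfl, ⟨hcv, hc⟩, hlast⟩ := P.exists_append_last_visit _ hex
  have hvP₂ : v ∉ P₂.support := fun hv ↦
    hP.ne_of_mem_support_of_append hcv.symm P₁.start_mem_support hv rfl
  have hlast' : ∀ w ∈ P₂.support, H.DoublyJoined v w → w = c := fun w hw hD ↦ by
    rw [← P₂.cons_tail_support, List.mem_cons] at hw
    rcases hw with rfl | hw
    · rfl
    · exact absurd ⟨fun h ↦ hvP₂ (h ▸ List.mem_of_mem_tail hw), hD⟩ (hlast w hw)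
  refine ⟨c, by simp, hcv, hc, fun Q ↦ ?_⟩
  by_contra hcQ
  obtain ⟨p₁, p₂, h₁, h₂, h⟩ := hc
  -- A walk avoiding `c` provides an ear `R` from the cycle `p₁ ∪ p₂` to the rest of `P`.
  obtain ⟨u, t, R, hR, hRQ, hu, ht, hRA, hRB⟩ := Q.exists_isPath_inter
    (A := {w | w ∈ p₁.support ∨ w ∈ p₂.support}) (B := {w | w ∈ P₂.support})
    (.inl p₁.start_mem_support) P₂.end_mem_support
  have huc : u ≠ c := fun e ↦ hcQ (hRQ (e ▸ R.start_mem_support))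
  have htc : t ≠ c := fun e ↦ hcQ (hRQ (e ▸ R.end_mem_support))
  wlog hu₁ : u ∈ p₁.support generalizing p₁ p₂
  · exact this p₂ p₁ h₂ h₁ (fun w h' h'' ↦ h w h'' h') hu.symm
      (fun w hw hw' ↦ hRA w hw hw'.symm) (hu.resolve_left hu₁)
  have hAD : ∀ w, w ∈ p₁.support ∨ w ∈ p₂.support → w ∈ P₂.support → w = c := by
    intro w hw hw'
    have hwv : w ≠ v := fun e ↦ hvP₂ (e ▸ hw')
    rcases hw with hw | hw
    · exact hlast' w hw' (doublyJoined_of_mem_support h₁ h₂ h hw hwv)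
    · exact hlast' w hw' (doublyJoined_of_mem_support h₂ h₁ (fun w h' h'' ↦ h w h'' h') hw hwv)
  have hP₂ : P₂.IsPath := hP.of_append_right
  have hcu : c ∉ (p₁.takeUntil u hu₁).support :=
    Walk.endpoint_notMem_support_takeUntil h₁ hu₁ huc.symm
  -- With the ear, the cycle can be rerouted through a vertex of `P` beyond `c`.
  refine htc (hlast' t ht ⟨(p₁.takeUntil u hu₁).append R, p₂.append (P₂.takeUntil t ht),
    (h₁.takeUntil hu₁).append_of_inter hR fun w hw hw' ↦
      hRA w hw' (.inl (p₁.support_takeUntil_subset_support hu₁ hw)),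
    h₂.append_of_inter (hP₂.takeUntil ht) fun w hw hw' ↦
      hAD w (.inr hw) (P₂.support_takeUntil_subset_support ht hw'), fun w hw hw' ↦ ?_⟩)
  rw [Walk.mem_support_append_iff] at hw hw'
  rcases hw with hw | hw <;> rcases hw' with hw' | hw'
  · rcases h w (p₁.support_takeUntil_subset_support hu₁ hw) hw' with rfl | rfl
    · exact .inl rfl
    · exact absurd hw hcu
  · obtain rfl := hAD w (.inl (p₁.support_takeUntil_subset_support hu₁ hw))
      (P₂.support_takeUntil_subset_support ht hw')
    exact absurd hw hcu
  · obtain rfl := hRA w hw (.inr hw')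
    rcases h w hu₁ hw' with rfl | rfl
    · exact .inl rfl
    · exact absurd rfl huc
  · exact .inr (hRB w hw (P₂.support_takeUntil_subset_support ht hw'))

/-- If no vertex within distance `R` of `x` lies on a cycle of `H` longer than `L`, then `x` is
separated in `H` from any vertex beyond distance `R + L` by a single vertex of the annulus between
the radii `R` and `R + L`. Distances are those of a larger graph `G`. -/
lemma Reachable.exists_separating_annulus {G H : SimpleGraph V} (hG : G.Connected) (hHG : H ≤ G)
    {x y : V} {R L : ℕ} (hL : 1 ≤ L)
    (hcyc : ∀ v, G.dist x v ≤ R → ∀ w : H.Walk v v, w.IsCycle → w.length ≤ L)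
    (hxy : H.Reachable x y) (hd : R + L < G.dist x y) :
    ∃ c, R < G.dist x c ∧ G.dist x c ≤ R + L ∧ ∀ Q : H.Walk x y, c ∈ Q.support := by
  obtain ⟨P, hP⟩ := hxy.exists_isPath
  obtain ⟨v, P₁, P₂, rfl, hv, hlast⟩ := P.exists_append_last_visit {z | G.dist x z ≤ R}
    ⟨x, by simp, by simp⟩
  have hv' : G.dist x v ≤ R := hv
  have hvy : v ≠ y := fun e ↦ by subst e; omega
  obtain ⟨c, hcP, hcv, hD, hsep⟩ := hP.of_append_right.exists_doublyJoined_separating hvy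
  have hcR : R < G.dist x c := by
    rw [← P₂.cons_tail_support, List.mem_cons] at hcP
    exact not_le.1 (hlast c (hcP.resolve_left hcv))
  refine ⟨c, hcR, ?_, fun Q ↦ ?_⟩
  · have h1 := hD.dist_le hHG hL (hcyc v hv)
    have h2 := hG.dist_triangle (u := x) (v := v) (w := c)
    omega
  · have h1 := hsep (P₁.reverse.append Q)
    rw [Walk.mem_support_append_iff, Walk.support_reverse, List.mem_reverse] at h1
    exact h1.resolve_left fun h2 ↦ hP.ne_of_mem_support_of_append hcv h2 hcP rfl

/-- Balls in a connected locally finite graph are finite. -/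
lemma Connected.finite_dist_le {G : SimpleGraph V} (hG : G.Connected)
    (hfin : ∀ v : V, (G.neighborSet v).Finite) (x : V) (R : ℕ) : {v | G.dist x v ≤ R}.Finite := by
  induction R with
  | zero =>
    refine (Set.finite_singleton x).subset fun v hv ↦ ?_
    have : G.dist x v = 0 := Nat.le_zero.1 hv
    exact (hG.dist_eq_zero_iff.1 this).symm
  | succ R ih =>
    refine (ih.union (ih.biUnion fun v _ ↦ hfin v)).subset fun v hv ↦ ?_
    rcases Nat.lt_or_ge R (G.dist x v) with h | h
    · right
      obtain ⟨w, hw⟩ := hG.exists_walk_length_eq_dist v x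
      cases w with
      | nil => simp at h
      | @cons _ b _ hadj p =>
        refine Set.mem_biUnion (x := b) ?_ hadj.symm
        have h1 : G.dist x b ≤ p.length := by
          rw [dist_comm]; exact SimpleGraph.dist_le p
        have h2 : G.dist x v ≤ R + 1 := hv
        rw [dist_comm] at h2
        simp only [Walk.length_cons] at hw
        change G.dist x b ≤ R
        omega
    · exact .inl h

end SimpleGraph

/-! ### Bernoulli random sets -/

namespace Percolation

variable {ι : Type*}

lemma setBernoulli_finset_subset (p : I) (S : Finset ι) :
    setBernoulli (Set.univ : Set ι) p {ω | ↑S ⊆ ω} = ENNReal.ofReal p ^ S.card := by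
  have h : (fun f : ι → Prop ↦ {i | f i}) ⁻¹' {ω | ↑S ⊆ ω} = Set.pi S fun _ ↦ {True} := by
    ext f; simp [Set.subset_def]
  rw [setBernoulli_apply', h, Measure.infinitePi_pi _ (fun _ _ ↦ .of_discrete)]
  have hp : ENNReal.ofReal p = unitInterval.toNNReal p := ENNReal.ofReal_eq_coe_nnreal p.2.1
  rw [hp, ← Finset.prod_const]
  refine Finset.prod_congr rfl fun i _ ↦ ?_
  rw [Measure.add_apply, Measure.smul_apply, Measure.smul_apply, ENNReal.smul_def, ENNReal.smul_def]
  simp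

lemma setBernoulli_finset_disjoint (p : I) (S : Finset ι) :
    setBernoulli (Set.univ : Set ι) p {ω | Disjoint (↑S) ω} = ENNReal.ofReal (1 - p) ^ S.card := by
  have h : (fun f : ι → Prop ↦ {i | f i}) ⁻¹' {ω | Disjoint (↑S) ω} = Set.pi S fun _ ↦ {False} := by
    ext f; simp [Set.disjoint_left]
  rw [setBernoulli_apply', h, Measure.infinitePi_pi _ (fun _ _ ↦ .of_discrete)]
  have hp : ENNReal.ofReal (1 - p) = unitInterval.toNNReal (unitInterval.symm p) :=
    ENNReal.ofReal_eq_coe_nnreal (unitInterval.symm p).2.1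
  rw [hp, ← Finset.prod_const]
  refine Finset.prod_congr rfl fun i _ ↦ ?_
  rw [Measure.add_apply, Measure.smul_apply, Measure.smul_apply, ENNReal.smul_def, ENNReal.smul_def]
  simp

lemma measurableSet_finset_subset (S : Finset ι) : MeasurableSet {ω : Set ι | ↑S ⊆ ω} := by
  have : {ω : Set ι | ↑S ⊆ ω} = ⋂ i ∈ S, {ω | i ∈ ω} := by ext; simp [Set.subset_def]
  rw [this]
  exact S.measurableSet_biInter fun i _ ↦ measurableSet_mem i

lemma measurableSet_finset_disjoint (S : Finset ι) :
    MeasurableSet {ω : Set ι | Disjoint (↑S) ω} := by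
  have : {ω : Set ι | Disjoint (↑S) ω} = ⋂ i ∈ S, {ω | i ∈ ω}ᶜ := by
    ext; simp [Set.disjoint_left]
  rw [this]
  exact S.measurableSet_biInter fun i _ ↦ (measurableSet_mem i).compl

/-- The law of a Bernoulli random set is determined by its inclusion probabilities. -/
lemma eq_setBernoulli {ν : Measure (Set ι)} [IsProbabilityMeasure ν] {p : I}
    (h : ∀ S : Finset ι, ν {ω | ↑S ⊆ ω} = ENNReal.ofReal p ^ S.card) :
    ν = setBernoulli Set.univ p := by
  classical
  refine ext_of_generate_finite (Set.range fun S : Finset ι ↦ {ω : Set ι | ↑S ⊆ ω}) ?_ ?_ ?_ ?_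
  · refine le_antisymm ?_ (MeasurableSpace.generateFrom_le ?_)
    · have hpi : (Set.instMeasurableSpace : MeasurableSpace (Set ι)) =
          ⨆ i, MeasurableSpace.comap (fun ω : Set ι ↦ i ∈ ω) ⊤ := rfl
      rw [hpi]
      refine iSup_le fun i ↦ ?_
      rintro _ ⟨t, -, rfl⟩
      have hi : MeasurableSet[MeasurableSpace.generateFrom
          (Set.range fun S : Finset ι ↦ {ω : Set ι | ↑S ⊆ ω})] {ω : Set ι | i ∈ ω} :=
        MeasurableSpace.measurableSet_generateFrom ⟨{i}, by simp⟩
      have key : (fun ω : Set ι ↦ i ∈ ω) ⁻¹' t =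
          ({ω : Set ι | i ∈ ω} ∩ {_ω | True ∈ t}) ∪ ({ω : Set ι | i ∈ ω}ᶜ ∩ {_ω | False ∈ t}) := by
        ext ω
        by_cases hf : i ∈ ω <;> simp [hf]
      rw [key]
      exact (hi.inter (.const _)).union (hi.compl.inter (.const _))
    · rintro _ ⟨S, rfl⟩
      exact measurableSet_finset_subset S
  · rintro _ ⟨S, rfl⟩ _ ⟨T, rfl⟩ -
    exact ⟨S ∪ T, by ext; simp⟩
  · rintro _ ⟨S, rfl⟩
    rw [h, setBernoulli_finset_subset]
  · simp

/-- Thinning: the intersection of two independent Bernoulli random sets is a Bernoulli random set,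
whose density is the product of the two densities. -/
lemma map_inter_setBernoulli_prod [Countable ι] (p q : I) :
    ((setBernoulli (Set.univ : Set ι) p).prod (setBernoulli Set.univ q)).map
      (fun x ↦ x.1 ∩ x.2) = setBernoulli Set.univ (p * q) := by
  have hm : Measurable fun x : Set ι × Set ι ↦ x.1 ∩ x.2 := by
    refine measurable_set_iff.2 fun i ↦ ?_
    exact ((measurable_set_mem i).comp measurable_fst).and
      ((measurable_set_mem i).comp measurable_snd)
  have := Measure.isProbabilityMeasure_map
    (μ := (setBernoulli (Set.univ : Set ι) p).prod (setBernoulli Set.univ q)) hm.aemeasurable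
  refine eq_setBernoulli fun S ↦ ?_
  have h : (fun x : Set ι × Set ι ↦ x.1 ∩ x.2) ⁻¹' {ω | ↑S ⊆ ω} =
      {ω | ↑S ⊆ ω} ×ˢ {ω | ↑S ⊆ ω} := by ext; simp
  rw [Measure.map_apply hm (measurableSet_finset_subset S), h, Measure.prod_prod,
    setBernoulli_finset_subset, setBernoulli_finset_subset, ← mul_pow,
    ← ENNReal.ofReal_mul p.2.1]
  simp

/-- The law of a Bernoulli random set is invariant under permutations of the ground set. -/
lemma setBernoulli_image_equiv (p : I) (e : ι ≃ ι) (A : Set (Set ι)) :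
    setBernoulli Set.univ p {ω | e '' ω ∈ A} = setBernoulli Set.univ p A := by
  classical
  let E : Set ι ≃ᵐ Set ι :=
    { toEquiv := Equiv.Set.congr e
      measurable_toFun := measurable_set_iff.2 fun i ↦ by
        simpa [Equiv.Set.congr, Set.mem_image_equiv] using measurable_set_mem (e.symm i)
      measurable_invFun := measurable_set_iff.2 fun i ↦ by
        simpa [Equiv.Set.congr, Set.mem_image_equiv] using measurable_set_mem (e i) }
  have hE : ∀ ω, E ω = e '' ω := fun ω ↦ rfl
  have := Measure.isProbabilityMeasure_map (μ := setBernoulli (Set.univ : Set ι) p)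
    E.measurable.aemeasurable
  have key : (setBernoulli Set.univ p).map E = setBernoulli Set.univ p := by
    refine eq_setBernoulli fun S ↦ ?_
    rw [E.map_apply, ← Finset.card_map e.symm.toEmbedding, ← setBernoulli_finset_subset]
    congr 1
    ext ω
    simp [hE, Set.subset_def, Set.mem_image_equiv]
  conv_rhs => rw [← key, E.map_apply]
  rfl

/-- Among several disjoint blocks of at most `D` elements, it is unlikely that none is missed by a
Bernoulli random set. -/
lemma setBernoulli_forall_not_disjoint_le {κ : Type*} (q : I) (K : Finset κ) (T : κ → Finset ι)
    (hT : (K : Set κ).PairwiseDisjoint T) {D : ℕ} (hD : ∀ k ∈ K, (T k).card ≤ D) :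
    setBernoulli Set.univ q {η | ∀ k ∈ K, ¬ Disjoint (T k : Set ι) η} ≤
      (1 - ENNReal.ofReal (1 - q) ^ D) ^ K.card := by
  classical
  set β : Measure (Set ι) := setBernoulli Set.univ q
  let f : K → Set (Set ι) := fun k ↦ {η | Disjoint (T k : Set ι) η}
  have hf : ∀ k, MeasurableSet (f k) := fun k ↦ measurableSet_finset_disjoint _
  have hind : iIndepSet f β := by
    rw [iIndepSet_iff_meas_biInter hf]
    intro s
    have h1 : ⋂ k ∈ s, f k = {η | Disjoint (↑(s.biUnion fun k ↦ T k)) η} := by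
      ext η; simp [f, Set.disjoint_left]; tauto
    rw [h1, setBernoulli_finset_disjoint, Finset.card_biUnion, ← Finset.prod_pow_eq_pow_sum]
    · exact Finset.prod_congr rfl fun k _ ↦ (setBernoulli_finset_disjoint q _).symm
    · exact fun a _ b _ hab ↦ hT a.2 b.2 fun e ↦ hab (Subtype.ext e)
  have h2 : {η : Set ι | ∀ k ∈ K, ¬ Disjoint (T k : Set ι) η} = ⋂ k, (f k)ᶜ := by
    ext η; simp [f]
  rw [h2, ((iIndepSet_iff_iIndep f β).1 hind).meas_iInter fun k ↦
    (MeasurableSpace.measurableSet_generateFrom (Set.mem_singleton (f k))).compl]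
  have hcard : (Finset.univ : Finset K).card = K.card := by simp
  rw [← hcard]
  refine Finset.prod_le_pow_card _ _ _ fun k _ ↦ ?_
  rw [prob_compl_eq_one_sub (hf k)]
  refine tsub_le_tsub_left ?_ 1
  rw [show β (f k) = _ from setBernoulli_finset_disjoint q _]
  refine pow_le_pow_right_of_le_one' ?_ (hD k k.2)
  exact ENNReal.ofReal_le_one.2 (by linarith [q.2.1])

end Percolation

/-! ### Growth of the number of simple cycles -/

namespace Percolation

variable {V ι : Type*}

/-- For a density `a` below `r`, this is an exponentially decaying bound for the expected number of
open simple cycles of length `n` through `o`. -/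
lemma eventually_numSimpleCycles_mul_pow_le {G : SimpleGraph V} {o : V}
    {r a : ℝ≥0∞} (h : r < cycleLiminf G o) :
    ∀ᶠ n in atTop, (numSimpleCycles G o n : ℝ≥0∞) * a ^ n ≤ (a / r) ^ n := by
  filter_upwards [eventually_lt_of_lt_liminf h, eventually_gt_atTop 0] with n hn hn0
  have hn0' : (n : ℝ) ≠ 0 := by exact_mod_cast hn0.ne'
  have h1 : r ^ n ≤ (numSimpleCycles G o n : ℝ≥0∞)⁻¹ := by
    have h2 : ((numSimpleCycles G o n : ℝ≥0∞) ^ (-(1 / (n : ℝ)))) ^ n =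
        (numSimpleCycles G o n : ℝ≥0∞)⁻¹ := by
      rw [← ENNReal.rpow_natCast, ← ENNReal.rpow_mul, neg_mul, one_div_mul_cancel hn0',
        ENNReal.rpow_neg_one]
    rw [← h2]
    gcongr
  rw [div_eq_mul_inv, mul_pow, mul_comm]
  gcongr
  rw [← ENNReal.inv_pow]
  exact ENNReal.le_inv_iff_le_inv.1 h1

/-! ### A common framework for bond and site percolation -/

/-- A percolation model on `G` driven by a random subset of `ι`: an edge `e` of `G` is usable when
all the (finitely many) elements of `req e` are open. For bond percolation `req e` consists of `e`
itself, for site percolation of the two endpoints of `e`.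

The set `star v` meets `req e` for all edges `e` at `v`, so that `v` is isolated once `star v` is
closed. The stars have bounded size, and those of vertices at distance at least `2` are disjoint. A
cycle of length `n` requires at least `n` open elements, and the automorphisms of `G` are induced by
permutations of `ι`. -/
structure Model (G : SimpleGraph V) (ι : Type*) where
  /-- the elements that have to be open for an edge to be usable -/
  req : Sym2 V → Finset ι
  /-- a set whose closure isolates the vertex -/
  star : V → Finset ι
  /-- a uniform bound for the size of the stars -/
  deg : ℕ
  card_star_le : ∀ v, (star v).card ≤ deg
  not_disjoint_req_star : ∀ v w, G.Adj v w → ¬ Disjoint (req s(v, w)) (star v)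
  disjoint_star : ∀ v w, 1 < G.dist v w → Disjoint (star v) (star w)
  length_le_card : ∀ (v : V) (w : G.Walk v v), w.IsCycle →
    ∀ S : Finset ι, (∀ e ∈ w.edges, req e ⊆ S) → w.length ≤ S.card
  exists_equiv : ∀ φ : G ≃g G, ∃ ψ : ι ≃ ι, ∀ e, req (e.map φ) = (req e).map ψ.toEmbedding

namespace Model

variable {G : SimpleGraph V} (M : Model G ι)

/-- The graph of the usable edges when the open elements are those of `ω`. -/
def openGraph (ω : Set ι) : SimpleGraph V where
  Adj a b := G.Adj a b ∧ ↑(M.req s(a, b)) ⊆ ω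
  symm := ⟨fun a b h ↦ ⟨h.1.symm, by rw [Sym2.eq_swap]; exact h.2⟩⟩
  loopless := ⟨fun a h ↦ h.1.ne rfl⟩

lemma openGraph_le (ω : Set ι) : M.openGraph ω ≤ G := fun _ _ h ↦ h.1

lemma openGraph_mono {ω ω' : Set ι} (h : ω ⊆ ω') : M.openGraph ω ≤ M.openGraph ω' :=
  fun _ _ hab ↦ ⟨hab.1, hab.2.trans h⟩

lemma req_subset_of_mem_edges {ω : Set ι} {x y : V} {w : (M.openGraph ω).Walk x y} {e : Sym2 V}
    (he : e ∈ w.edges) : ↑(M.req e) ⊆ ω := by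
  induction e with
  | _ a b => exact (w.adj_of_mem_edges he).2

lemma measurableSet_reachable [Countable V] (x y : V) :
    MeasurableSet {ω | (M.openGraph ω).Reachable x y} := by
  have : Countable (G.Walk x y) :=
    Function.Injective.countable (f := fun w : G.Walk x y ↦ w.support)
      fun _ _ h ↦ SimpleGraph.Walk.ext_support h
  have h : {ω | (M.openGraph ω).Reachable x y} =
      ⋃ w : G.Walk x y, ⋂ e ∈ {e | e ∈ w.edges}, {ω | ↑(M.req e) ⊆ ω} := by
    ext ω
    simp only [Set.mem_ofPred_eq, Set.mem_iUnion, Set.mem_iInter]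
    refine ⟨fun ⟨w⟩ ↦ ⟨w.mapLe (M.openGraph_le ω), fun e he ↦ ?_⟩, fun ⟨w, hw⟩ ↦ ?_⟩
    · exact M.req_subset_of_mem_edges (by simpa using he)
    · refine ⟨w.transfer _ fun e he ↦ ?_⟩
      induction e with
      | _ a b => exact ⟨w.adj_of_mem_edges he, hw _ he⟩
  rw [h]
  exact .iUnion fun w ↦ .biInter (List.finite_toSet _).countable
    fun e _ ↦ measurableSet_finset_subset _

/-- In a transitive graph, the probability that the open graph has a given property at a vertex
does not depend on the vertex. -/
lemma setBernoulli_openGraph_eq (htrans : IsTransitive G) (p : I) (P : SimpleGraph V → V → Prop)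
    (hP : ∀ (H H' : SimpleGraph V) (f : H ≃g H') (x : V), P H x → P H' (f x)) (x y : V) :
    setBernoulli Set.univ p {ω | P (M.openGraph ω) x} =
      setBernoulli Set.univ p {ω | P (M.openGraph ω) y} := by
  obtain ⟨φ, rfl⟩ := htrans x y
  obtain ⟨ψ, hψ⟩ := M.exists_equiv φ
  have hf : ∀ (ω : Set ι) (a b : V),
      (M.openGraph (ψ '' ω)).Adj (φ a) (φ b) ↔ (M.openGraph ω).Adj a b := by
    intro ω a b
    have h1 : M.req s(φ a, φ b) = (M.req s(a, b)).map ψ.toEmbedding := hψ s(a, b)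
    simp [openGraph, h1, φ.map_adj_iff]
  let f : ∀ ω, M.openGraph ω ≃g M.openGraph (ψ '' ω) := fun ω ↦ ⟨φ.toEquiv, hf ω _ _⟩
  rw [← setBernoulli_image_equiv p ψ {ω | P (M.openGraph ω) (φ x)}]
  congr 1
  ext ω
  refine ⟨fun h ↦ hP _ _ (f ω) x h, fun h ↦ ?_⟩
  have := hP _ _ (f ω).symm (φ x) h
  rwa [show (f ω).symm (φ x) = x from (f ω).symm_apply_apply x] at this

/-! ### Long open cycles -/

lemma setBernoulli_exists_isCycle_le {p : I} (hp : 0 < p) (v : V) (n : ℕ) :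
    setBernoulli Set.univ p {ω | ∃ w : (M.openGraph ω).Walk v v, w.IsCycle ∧ w.length = n} ≤
      (numSimpleCycles G v n : ℝ≥0∞) * ENNReal.ofReal p ^ n := by
  classical
  have hp' : ENNReal.ofReal p ≠ 0 := by simpa using hp
  by_cases hfin : (simpleCycles G v n).Finite
  swap
  · have : numSimpleCycles G v n = ⊤ := Set.encard_eq_top_iff.2 hfin
    simp [this, ENNReal.top_mul (pow_ne_zero n hp')]
  have hsub : {ω | ∃ w : (M.openGraph ω).Walk v v, w.IsCycle ∧ w.length = n} ⊆
      ⋃ C ∈ simpleCycles G v n, {ω : Set ι | ∀ e ∈ C.edgeSet, ↑(M.req e) ⊆ ω} := by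
    rintro ω ⟨w, hw, rfl⟩
    refine Set.mem_biUnion (x := (w.mapLe (M.openGraph_le ω)).toSubgraph)
      ⟨by simp, v, w.mapLe (M.openGraph_le ω), hw.mapLe _, by simp, rfl⟩ fun e he ↦ ?_
    rw [SimpleGraph.Walk.mem_edges_toSubgraph] at he
    exact M.req_subset_of_mem_edges (by simpa using he)
  refine (measure_mono hsub).trans ((measure_biUnion_le _ hfin.countable _).trans ?_)
  rw [numSimpleCycles, ← ENNReal.tsum_set_const]
  refine ENNReal.tsum_le_tsum fun ⟨C, hC⟩ ↦ ?_
  obtain ⟨-, a, w, hw, rfl, rfl⟩ := hC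
  let S : Finset ι := w.edges.toFinset.biUnion M.req
  have hS : {ω : Set ι | ∀ e ∈ w.toSubgraph.edgeSet, ↑(M.req e) ⊆ ω} ⊆ {ω | ↑S ⊆ ω} := by
    intro ω hω i hi
    obtain ⟨e, he, hi⟩ := Finset.mem_biUnion.1 (Finset.mem_coe.1 hi)
    exact hω e (by simpa using he) hi
  refine (measure_mono hS).trans ?_
  rw [setBernoulli_finset_subset]
  exact pow_le_pow_right_of_le_one' (ENNReal.ofReal_le_one.2 p.2.2)
    (M.length_le_card a w hw S fun e he ↦ Finset.subset_biUnion_of_mem M.req (by simpa using he))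

/-- If the expected number of open cycles of length `n` through a vertex decays exponentially in
`n`, then long open cycles near a given vertex are unlikely. -/
lemma exists_setBernoulli_long_cycle_le (hconn : G.Connected)
    (hfin : ∀ v : V, (G.neighborSet v).Finite) (htrans : IsTransitive G) {p : I} (hp : 0 < p)
    {o : V} {s : ℝ≥0∞} (hs : s < 1)
    (ho : ∀ᶠ n in atTop, (numSimpleCycles G o n : ℝ≥0∞) * ENNReal.ofReal p ^ n ≤ s ^ n)
    (x : V) (R : ℕ) {δ : ℝ≥0∞} (hδ : δ ≠ 0) :
    ∃ L, 1 ≤ L ∧ setBernoulli Set.univ p {ω | ¬ ∀ v, G.dist x v ≤ R →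
      ∀ w : (M.openGraph ω).Walk v v, w.IsCycle → w.length ≤ L} ≤ δ := by
  set β : Measure (Set ι) := setBernoulli Set.univ p
  obtain ⟨N, hN⟩ := eventually_atTop.1 ho
  let B := (hconn.finite_dist_le hfin x R).toFinset
  let P : ℕ → SimpleGraph V → V → Prop := fun L H v ↦
    ∃ w : H.Walk v v, w.IsCycle ∧ L < w.length
  have hPo : ∀ L, N ≤ L → β {ω | P L (M.openGraph ω) o} ≤ ∑' n, s ^ (n + L) := by
    intro L hL
    have hsub : {ω | P L (M.openGraph ω) o} ⊆ ⋃ n : ℕ,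
        {ω | ∃ w : (M.openGraph ω).Walk o o, w.IsCycle ∧ w.length = n + L} := by
      rintro ω ⟨w, hw, hlt⟩
      exact Set.mem_iUnion.2 ⟨w.length - L, w, hw, by omega⟩
    refine (measure_mono hsub).trans ((measure_iUnion_le _).trans (ENNReal.tsum_le_tsum fun n ↦ ?_))
    exact (M.setBernoulli_exists_isCycle_le hp o (n + L)).trans (hN _ (by omega))
  have hlim : Tendsto (fun L ↦ (B.card : ℝ≥0∞) * ∑' n, s ^ (n + L)) atTop (nhds 0) := by
    have h1 : ∑' n : ℕ, s ^ n ≠ ⊤ := by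
      rw [ENNReal.tsum_geometric]
      exact ENNReal.inv_ne_top.2 (tsub_pos_of_lt hs).ne'
    simpa using ENNReal.Tendsto.const_mul (ENNReal.tendsto_sum_nat_add _ h1)
      (.inr (ENNReal.natCast_ne_top B.card))
  obtain ⟨L, hL₁, hL₂⟩ := ((hlim.eventually (ge_mem_nhds (pos_iff_ne_zero.2 hδ))).and
    (eventually_ge_atTop (max 1 N))).exists
  refine ⟨L, le_of_max_le_left hL₂, le_trans ?_ hL₁⟩
  have hsub : {ω | ¬ ∀ v, G.dist x v ≤ R → ∀ w : (M.openGraph ω).Walk v v, w.IsCycle →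
      w.length ≤ L} ⊆ ⋃ v ∈ B, {ω | P L (M.openGraph ω) v} := by
    intro ω hω
    simp only [Set.mem_ofPred_eq] at hω
    push Not at hω
    obtain ⟨v, hv, w, hw, hlt⟩ := hω
    exact Set.mem_biUnion (x := v) (by simpa [B] using hv) ⟨w, hw, hlt⟩
  refine (measure_mono hsub).trans ((measure_biUnion_finset_le _ _).trans ?_)
  rw [← nsmul_eq_mul]
  refine Finset.sum_le_card_nsmul _ _ _ fun v _ ↦ ?_
  refine (M.setBernoulli_openGraph_eq htrans p (P L) ?_ v o).trans_le
    (hPo L (le_of_max_le_right hL₂))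
  rintro H H' f z ⟨w, hw, hlt⟩
  exact ⟨w.map f.toHom, hw.map f.injective, by simpa using hlt⟩

/-! ### Decay of the two-point function -/

/-- If `x` is separated from `y` by cut vertices of the open graph in many distant annuli, then
thinning the configuration is likely to disconnect `x` from `y`. -/
lemma setBernoulli_reachable_inter_le (hconn : G.Connected) {ω : Set ι} {x y : V} (q : I) (k : ℕ)
    (r : ℕ → ℕ) (hr : Monotone r) (hsep : ∀ i < k, ∃ c, r i < G.dist x c ∧ G.dist x c < r (i + 1) ∧
      ∀ Q : (M.openGraph ω).Walk x y, c ∈ Q.support) :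
    setBernoulli Set.univ q {η | (M.openGraph (ω ∩ η)).Reachable x y} ≤
      (1 - ENNReal.ofReal (1 - q) ^ M.deg) ^ k := by
  have hsep' : ∀ i, ∃ c, i < k → r i < G.dist x c ∧ G.dist x c < r (i + 1) ∧
      ∀ Q : (M.openGraph ω).Walk x y, c ∈ Q.support := by
    intro i
    by_cases hi : i < k
    · obtain ⟨c, hc⟩ := hsep i hi
      exact ⟨c, fun _ ↦ hc⟩
    · exact ⟨x, fun h ↦ absurd h hi⟩
  choose c hc using hsep'
  have hdist : ∀ i j, i < j → j < k → 1 < G.dist (c i) (c j) := by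
    intro i j hij hj
    have h1 := (hc i (hij.trans hj)).2.1
    have h2 := (hc j hj).1
    have h3 : r (i + 1) ≤ r j := hr hij
    have h4 := hconn.dist_triangle (u := x) (v := c i) (w := c j)
    omega
  have hdisj : ((Finset.range k : Finset ℕ) : Set ℕ).PairwiseDisjoint fun i ↦ M.star (c i) := by
    intro i hi j hj hij
    simp only [Finset.coe_range, Set.mem_Iio] at hi hj
    rcases lt_or_gt_of_ne hij with h | h
    · exact M.disjoint_star _ _ (hdist i j h hj)
    · exact (M.disjoint_star _ _ (hdist j i h hi)).symm
  have h := setBernoulli_forall_not_disjoint_le q (Finset.range k) (fun i ↦ M.star (c i)) hdisj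
    fun i _ ↦ M.card_star_le (c i)
  rw [Finset.card_range] at h
  refine (measure_mono ?_).trans h
  rintro η ⟨Q⟩ i hi
  obtain ⟨h1, -, h3⟩ := hc i (Finset.mem_range.1 hi)
  have hQ : c i ∈ Q.support := by
    simpa using h3 (Q.mapLe (M.openGraph_mono Set.inter_subset_left))
  -- The walk uses an edge at the cut vertex, whose requirement meets the star of that vertex.
  classical
  have hne : c i ≠ x := fun e ↦ by simp [e] at h1
  obtain ⟨b, hadj⟩ : ∃ b, (M.openGraph (ω ∩ η)).Adj (c i) b := by
    cases hw : (Q.takeUntil (c i) hQ).reverse with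
    | nil => exact absurd rfl hne
    | cons hadj _ => exact ⟨_, hadj⟩
  obtain ⟨e, he, he'⟩ := Finset.not_disjoint_iff.1 (M.not_disjoint_req_star _ _ hadj.1)
  exact Set.not_disjoint_iff.2 ⟨e, he', (hadj.2 he).2⟩

/-- If the expected number of open cycles of length `n` through a vertex decays exponentially at
density `p'`, then at any smaller density the two-point function vanishes at infinity. -/
lemma finite_lt_setBernoulli_reachable [Countable V] [Countable ι] (hconn : G.Connected)
    (hfin : ∀ v : V, (G.neighborSet v).Finite) (htrans : IsTransitive G) {p' q : I} (hp : 0 < p')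
    (hq : q < 1) {o : V} {s : ℝ≥0∞} (hs : s < 1)
    (ho : ∀ᶠ n in atTop, (numSimpleCycles G o n : ℝ≥0∞) * ENNReal.ofReal p' ^ n ≤ s ^ n)
    (x : V) {ε : ℝ≥0∞} (hε : ε ≠ 0) :
    {y | ε < setBernoulli Set.univ (p' * q) {ω | (M.openGraph ω).Reachable x y}}.Finite := by
  have hε2 : ε / 2 ≠ 0 := by simpa using hε
  obtain ⟨k, hk⟩ : ∃ k : ℕ, (1 - ENNReal.ofReal (1 - q) ^ M.deg) ^ k ≤ ε / 2 := by
    have h1 : 1 - ENNReal.ofReal (1 - q) ^ M.deg < 1 := by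
      refine ENNReal.sub_lt_self ENNReal.one_ne_top one_ne_zero (pow_ne_zero _ ?_)
      have : (q : ℝ) < 1 := hq
      simpa using this
    exact ((ENNReal.tendsto_pow_atTop_nhds_zero_of_lt_one h1).eventually
      (ge_mem_nhds (pos_iff_ne_zero.2 hε2))).exists
  have hδ : ε / 2 / (k + 1 : ℕ) ≠ 0 :=
    (ENNReal.div_pos hε2 (ENNReal.natCast_ne_top _)).ne'
  choose L hL₁ hL₂ using fun R ↦
    M.exists_setBernoulli_long_cycle_le hconn hfin htrans hp hs ho x R hδ
  -- The annuli between consecutive radii: each one contains a cut vertex with high probability.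
  let r : ℕ → ℕ := fun n ↦ Nat.rec 0 (fun _ R ↦ R + L R + 1) n
  have hr : ∀ i, r (i + 1) = r i + L (r i) + 1 := fun i ↦ rfl
  have hmono : Monotone r := monotone_nat_of_le_succ fun i ↦ by rw [hr]; omega
  refine (hconn.finite_dist_le hfin x (r k)).subset fun y hy ↦ ?_
  by_contra hd
  have hd : r k < G.dist x y := not_le.1 hd
  refine absurd (show ε < _ from hy) (not_lt.2 ?_)
  let bad : ℕ → Set (Set ι) := fun i ↦ {ω | ¬ ∀ v, G.dist x v ≤ r i →
      ∀ w : (M.openGraph ω).Walk v v, w.IsCycle → w.length ≤ L (r i)}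
  let Γ : Set (Set ι) := ⋃ i ∈ Finset.range k, bad i
  have hΓ : setBernoulli Set.univ p' Γ ≤ ε / 2 := by
    refine (measure_biUnion_finset_le _ _).trans
      ((Finset.sum_le_card_nsmul _ _ _ fun i _ ↦ hL₂ (r i)).trans ?_)
    rw [Finset.card_range, nsmul_eq_mul, mul_comm]
    refine (mul_le_mul_right (Nat.cast_le.2 (Nat.le_succ k)) _).trans ?_
    exact (ENNReal.div_mul_cancel (by simp) (ENNReal.natCast_ne_top _)).le
  have hm : Measurable fun z : Set ι × Set ι ↦ z.1 ∩ z.2 :=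
    measurable_set_iff.2 fun i ↦ ((measurable_set_mem i).comp measurable_fst).and
      ((measurable_set_mem i).comp measurable_snd)
  have hmeas := M.measurableSet_reachable x y
  rw [← map_inter_setBernoulli_prod, Measure.map_apply hm hmeas,
    Measure.prod_apply (hm hmeas)]
  have hbound : ∀ ω : Set ι, setBernoulli Set.univ q (Prod.mk ω ⁻¹'
      ((fun z : Set ι × Set ι ↦ z.1 ∩ z.2) ⁻¹' {ω | (M.openGraph ω).Reachable x y})) ≤
      Γ.indicator (fun _ ↦ 1) ω + ε / 2 := by
    intro ω
    by_cases hω : ω ∈ Γ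
    · rw [Set.indicator_of_mem hω]
      exact prob_le_one.trans le_self_add
    rw [Set.indicator_of_notMem hω, zero_add]
    change setBernoulli Set.univ q {η | (M.openGraph (ω ∩ η)).Reachable x y} ≤ ε / 2
    by_cases hxy : (M.openGraph ω).Reachable x y
    · refine (M.setBernoulli_reachable_inter_le hconn q k r hmono fun i hi ↦ ?_).trans hk
      have hgood : ∀ v, G.dist x v ≤ r i →
          ∀ w : (M.openGraph ω).Walk v v, w.IsCycle → w.length ≤ L (r i) := by
        by_contra hbad
        exact hω (Set.mem_biUnion (x := i) (Finset.mem_coe.2 (Finset.mem_range.2 hi)) hbad)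
      have h1 := hmono (show i + 1 ≤ k from hi)
      have h2 := hr i
      obtain ⟨c, hc₁, hc₂, hc₃⟩ := hxy.exists_separating_annulus hconn (M.openGraph_le ω)
        (hL₁ (r i)) hgood (by omega)
      exact ⟨c, hc₁, by omega, hc₃⟩
    · have : {η | (M.openGraph (ω ∩ η)).Reachable x y} = ∅ :=
        Set.eq_empty_of_forall_notMem fun η h ↦
          hxy (SimpleGraph.Reachable.mono (M.openGraph_mono Set.inter_subset_left) h)
      simp [this]
  refine (lintegral_mono hbound).trans ?_
  rw [lintegral_add_right _ measurable_const, lintegral_const, measure_univ, mul_one]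
  calc _ ≤ ε / 2 + ε / 2 := by
        gcongr
        exact ((lintegral_indicator_const_le Γ 1).trans_eq (one_mul _)).trans hΓ
    _ = ε := ENNReal.add_halves ε

/-! ### Uniqueness of the infinite cluster -/

lemma measurableSet_infinite_cluster [Countable V] (x : V) :
    MeasurableSet {ω | {y | (M.openGraph ω).Reachable x y}.Infinite} := by
  have : {ω | {y | (M.openGraph ω).Reachable x y}.Infinite} =
      ⋂ S : Finset V, ⋃ y ∈ (S : Set V)ᶜ, {ω | (M.openGraph ω).Reachable x y} := by
    ext ω
    simp only [Set.mem_ofPred_eq, Set.mem_iInter, Set.mem_iUnion]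
    refine ⟨fun h S ↦ ?_, fun h hf ↦ ?_⟩
    · obtain ⟨y, hy, hyS⟩ := h.exists_notMem_finset S
      exact ⟨y, hyS, hy⟩
    · obtain ⟨y, hyS, hy⟩ := h hf.toFinset
      exact hyS (by simpa using hy)
  rw [this]
  exact .iInter fun S ↦ .biUnion (Set.to_countable _) fun y _ ↦ M.measurableSet_reachable x y

/-- If almost surely there is exactly one infinite cluster, then the two-point function of a
transitive graph does not vanish at infinity: the events that given vertices belong to the infinite
cluster have the same positive probability, hence cannot be almost disjoint for arbitrarily many
vertices. -/
lemma exists_infinite_lt_setBernoulli_reachable [Countable V] (htrans : IsTransitive G) {p : I}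
    (hex : ∀ᵐ ω ∂(setBernoulli Set.univ p : Measure (Set ι)),
      ∃ x, {y | (M.openGraph ω).Reachable x y}.Infinite)
    (huniq : ∀ᵐ ω ∂(setBernoulli Set.univ p : Measure (Set ι)), ∀ x y,
      {z | (M.openGraph ω).Reachable x z}.Infinite →
      {z | (M.openGraph ω).Reachable y z}.Infinite → (M.openGraph ω).Reachable x y) :
    ∃ (x : V) (ε : ℝ≥0∞), ε ≠ 0 ∧
      {y | ε < setBernoulli Set.univ p {ω | (M.openGraph ω).Reachable x y}}.Infinite := by
  classical
  set β : Measure (Set ι) := setBernoulli Set.univ p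
  by_contra! hno
  let A : V → Set (Set ι) := fun x ↦ {ω | {y | (M.openGraph ω).Reachable x y}.Infinite}
  have hA : ∀ x, MeasurableSet (A x) := M.measurableSet_infinite_cluster
  obtain ⟨x₀, hx₀⟩ : ∃ x, β (A x) ≠ 0 := by
    by_contra! h
    have h1 : β (⋃ x, A x) = 0 := measure_iUnion_null h
    have h2 : ∀ᵐ ω ∂β, ω ∈ ⋃ x, A x := hex.mono fun ω ⟨x, hx⟩ ↦ Set.mem_iUnion.2 ⟨x, hx⟩
    have h3 : ∀ᵐ ω ∂β, False := by
      filter_upwards [h2, measure_eq_zero_iff_ae_notMem.1 h1] with ω h h'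
      exact h' h
    simp [β, IsProbabilityMeasure.ne_zero] at h3
  have : Infinite V := by
    by_contra hV
    have := not_infinite_iff_finite.1 hV
    exact hx₀ (by simp [A, Set.not_infinite.2 (Set.toFinite _)])
  set θ := β (A x₀)
  have hθ : ∀ x, β (A x) = θ := fun x ↦ by
    refine M.setBernoulli_openGraph_eq htrans p
      (fun H x ↦ {y | H.Reachable x y}.Infinite) (fun H H' f z h ↦ ?_) x x₀
    refine (h.image f.injective.injOn).mono ?_
    rintro _ ⟨y, hy, rfl⟩
    exact SimpleGraph.Reachable.map f.toHom hy
  have hinter : ∀ x y, β (A x ∩ A y) ≤ β {ω | (M.openGraph ω).Reachable x y} := fun x y ↦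
    measure_mono_ae (huniq.mono fun ω h hω ↦ h x y hω.1 hω.2)
  have hθ2 : θ / 2 ≠ 0 := by simpa using hx₀
  have hθt : θ ≠ ⊤ := measure_ne_top _ _
  -- Each new vertex, chosen far from the previous ones, adds at least `θ / 2` to the union.
  have hstep : ∀ k : ℕ, ∃ S : Finset V, k * (θ / 2) ≤ β (⋃ x ∈ S, A x) := by
    intro k
    induction k with
    | zero => exact ⟨∅, by simp⟩
    | succ k ih =>
      obtain ⟨S, hS⟩ := ih
      have hδ : θ / 2 / (S.card + 1 : ℕ) ≠ 0 :=
        (ENNReal.div_pos hθ2 (ENNReal.natCast_ne_top _)).ne'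
      obtain ⟨y, hy⟩ := (S.finite_toSet.biUnion fun x _ ↦
        hno x _ hδ).infinite_compl.nonempty
      have hy' : ∀ x ∈ S, β (A x ∩ A y) ≤ θ / 2 / (S.card + 1 : ℕ) := fun x hx ↦
        (hinter x y).trans (not_lt.1 fun h ↦ hy (Set.mem_biUnion (x := x) hx h))
      refine ⟨insert y S, ?_⟩
      set U := ⋃ x ∈ S, A x
      have hUy : β (U ∩ A y) ≤ θ / 2 := by
        rw [Set.iUnion₂_inter]
        refine (measure_biUnion_finset_le _ _).trans
          ((Finset.sum_le_card_nsmul _ _ _ hy').trans ?_)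
        rw [nsmul_eq_mul, mul_comm]
        refine (mul_le_mul_right (Nat.cast_le.2 (Nat.le_succ S.card)) _).trans ?_
        exact (ENNReal.div_mul_cancel (by simp) (ENNReal.natCast_ne_top _)).le
      have h1 := measure_union_add_inter (μ := β) U (hA y)
      have h2 : ⋃ x ∈ insert y S, A x = U ∪ A y := by
        rw [Finset.set_biUnion_insert, Set.union_comm]
      rw [h2]
      rw [hθ y] at h1
      have h3 : ((k + 1 : ℕ) : ℝ≥0∞) * (θ / 2) + θ / 2 ≤ β (U ∪ A y) + θ / 2 := by
        calc ((k + 1 : ℕ) : ℝ≥0∞) * (θ / 2) + θ / 2 = k * (θ / 2) + (θ / 2 + θ / 2) := by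
              push_cast; ring
          _ ≤ β U + θ := by rw [ENNReal.add_halves]; gcongr
          _ = β (U ∪ A y) + β (U ∩ A y) := h1.symm
          _ ≤ _ := by gcongr
      exact (ENNReal.add_le_add_iff_right (ENNReal.div_ne_top hθt (by simp))).1 h3
  obtain ⟨k, hk⟩ := ENNReal.exists_nat_mul_gt hθ2 ENNReal.one_ne_top
  obtain ⟨S, hS⟩ := hstep k
  exact absurd (hk.trans_le (hS.trans prob_le_one)) (lt_irrefl _)

/-- The cycle bound for the densities at which a percolation model on a transitive graph has exactly
one infinite cluster. -/
theorem min_one_cycleLiminf_le [Countable V] [Countable ι] (hconn : G.Connected)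
    (hfin : ∀ v : V, (G.neighborSet v).Finite) (htrans : IsTransitive G) (o : V) {p : I}
    (hex : ∀ᵐ ω ∂(setBernoulli Set.univ p : Measure (Set ι)),
      ∃ x, {y | (M.openGraph ω).Reachable x y}.Infinite)
    (huniq : ∀ᵐ ω ∂(setBernoulli Set.univ p : Measure (Set ι)), ∀ x y,
      {z | (M.openGraph ω).Reachable x z}.Infinite →
      {z | (M.openGraph ω).Reachable y z}.Infinite → (M.openGraph ω).Reachable x y) :
    min 1 (cycleLiminf G o) ≤ ENNReal.ofReal p := by
  by_contra! hlt
  obtain ⟨r, hpr, hrmin⟩ := exists_between hlt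
  have hr1 : r < 1 := hrmin.trans_le (min_le_left _ _)
  have hrl : r < cycleLiminf G o := hrmin.trans_le (min_le_right _ _)
  -- A density `p'` strictly between `p` and `r` leaves room for thinning down to `p`.
  obtain ⟨t, hpt, htr⟩ := exists_between hpr
  have htt : t ≠ ⊤ := htr.ne_top
  have hp0 : (0 : ℝ) ≤ p := p.2.1
  have hpt' : (p : ℝ) < t.toReal := (ENNReal.ofReal_lt_iff_lt_toReal hp0 htt).1 hpt
  have ht1 : t.toReal ≤ 1 := by
    simpa using ENNReal.toReal_mono ENNReal.one_ne_top (htr.trans hr1).le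
  have ht0 : 0 < t.toReal := hp0.trans_lt hpt'
  let p' : I := ⟨t.toReal, ht0.le, ht1⟩
  let q : I := ⟨p / t.toReal, div_nonneg hp0 ht0.le, (div_le_one ht0).2 hpt'.le⟩
  have hpq : p = p' * q := Subtype.ext (by simp [p', q, mul_div_cancel₀ _ ht0.ne'])
  have hq : q < 1 := Subtype.coe_lt_coe.1 (by simpa [q] using (div_lt_one ht0).2 hpt')
  have hp't : ENNReal.ofReal p' = t := ENNReal.ofReal_toReal htt
  have ho := eventually_numSimpleCycles_mul_pow_le (a := t) hrl
  obtain ⟨x, ε, hε, hinf⟩ := M.exists_infinite_lt_setBernoulli_reachable htrans hex huniq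
  rw [hpq] at hinf
  exact hinf (M.finite_lt_setBernoulli_reachable hconn hfin htrans
    (p' := p') (q := q) (s := t / r) (Subtype.coe_lt_coe.1 (by simpa [p'] using ht0)) hq
    (ENNReal.div_lt_of_lt_mul (by simpa using htr)) (by simpa only [hp't] using ho) x hε)

end Model

end Percolation

/-! ### Bond percolation -/

namespace Percolation

variable {V : Type*} {G : SimpleGraph V}

open Classical in
/-- The open elements required by an edge in bond percolation: the edge itself. Pairs that are not
edges require nothing. -/
noncomputable def bondReq (G : SimpleGraph V) (e : Sym2 V) : Finset G.edgeSet :=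
  if h : e ∈ G.edgeSet then {⟨e, h⟩} else ∅

lemma mem_bondReq {e : Sym2 V} {i : G.edgeSet} : i ∈ bondReq G e ↔ i.1 = e := by
  unfold bondReq
  split_ifs with h
  · simp [Subtype.ext_iff]
  · simp only [Finset.notMem_empty, false_iff]
    exact fun hi ↦ h (hi ▸ i.2)

lemma card_bondReq_le (e : Sym2 V) : (bondReq G e).card ≤ 1 :=
  Finset.card_le_one.2 fun _ ha _ hb ↦
    Subtype.ext ((mem_bondReq.1 ha).trans (mem_bondReq.1 hb).symm)

open Classical in
/-- Bond percolation on a transitive locally finite graph as a percolation model. -/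
noncomputable def bondModel (hfin : ∀ v : V, (G.neighborSet v).Finite) (htrans : IsTransitive G)
    (o : V) : Model G G.edgeSet where
  req := bondReq G
  star v := (hfin v).toFinset.biUnion fun w ↦ bondReq G s(v, w)
  deg := (G.neighborSet o).ncard
  card_star_le v := by
    obtain ⟨φ, rfl⟩ := htrans o v
    rw [show (G.neighborSet o).ncard = (G.neighborSet (φ o)).ncard from
      Nat.card_congr (φ.mapNeighborSet o), Set.ncard_eq_toFinset_card _ (hfin _)]
    simpa using Finset.card_biUnion_le_card_mul _ _ 1 fun w _ ↦ card_bondReq_le _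
  not_disjoint_req_star v w h := Finset.not_disjoint_iff.2 ⟨⟨s(v, w), h⟩, mem_bondReq.2 rfl,
    Finset.mem_biUnion.2 ⟨w, by simpa using h, mem_bondReq.2 rfl⟩⟩
  disjoint_star v w h := by
    refine Finset.disjoint_left.2 fun i hi hi' ↦ ?_
    obtain ⟨a, ha, hia⟩ := Finset.mem_biUnion.1 hi
    obtain ⟨b, hb, hib⟩ := Finset.mem_biUnion.1 hi'
    have hva : G.Adj v a := by simpa using ha
    have he := (mem_bondReq.1 hia).symm.trans (mem_bondReq.1 hib)
    rcases Sym2.eq_iff.1 he with ⟨rfl, -⟩ | ⟨-, rfl⟩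
    · simp at h
    · rw [SimpleGraph.dist_eq_one_iff_adj.2 hva] at h
      exact lt_irrefl _ h
  length_le_card v w hw S hS := by
    rw [← w.length_edges, ← List.toFinset_card_of_nodup hw.edges_nodup]
    refine (Finset.card_le_card fun e he ↦ ?_).trans (Finset.card_image_le (f := Subtype.val))
    have he' : e ∈ w.edges := by simpa using he
    exact Finset.mem_image.2 ⟨⟨e, w.edges_subset_edgeSet he'⟩, hS e he' (mem_bondReq.2 rfl), rfl⟩
  exists_equiv φ := by
    refine ⟨φ.mapEdgeSet, fun e ↦ ?_⟩
    ext i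
    rw [mem_bondReq, Finset.mem_map_equiv, mem_bondReq]
    change i.1 = e.map φ ↔ i.1.map φ.symm = e
    constructor
    · intro h
      rw [h, Sym2.map_map, show (φ.symm ∘ φ : V → V) = id from funext φ.symm_apply_apply,
        Sym2.map_id, id]
    · rintro rfl
      rw [Sym2.map_map, show (φ ∘ φ.symm : V → V) = id from funext φ.apply_symm_apply,
        Sym2.map_id, id]

lemma openGraph_bondModel (hfin : ∀ v : V, (G.neighborSet v).Finite) (htrans : IsTransitive G)
    (o : V) (ω : Set G.edgeSet) : (bondModel hfin htrans o).openGraph ω = bondSubgraph G ω := by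
  ext a b
  simp only [Model.openGraph, bondSubgraph, SimpleGraph.fromEdgeSet_adj, bondModel]
  constructor
  · rintro ⟨h, hω⟩
    exact ⟨⟨⟨s(a, b), h⟩, hω (Finset.mem_coe.2 (mem_bondReq.2 rfl)), rfl⟩, h.ne⟩
  · rintro ⟨⟨e, he, hab⟩, -⟩
    refine ⟨by simpa [hab] using e.2, fun i hi ↦ ?_⟩
    rwa [show i = e from Subtype.ext ((mem_bondReq.1 (Finset.mem_coe.1 hi)).trans hab.symm)]

/-! ### Site percolation -/

open Classical in
/-- Site percolation as a percolation model: an edge requires its endpoints to be open. -/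
noncomputable def siteModel (G : SimpleGraph V) : Model G V where
  req e := e.toFinset
  star v := {v}
  deg := 1
  card_star_le v := by simp
  not_disjoint_req_star v w h := by simp
  disjoint_star v w h := by
    rw [Finset.disjoint_singleton]
    rintro rfl
    simp at h
  length_le_card v w hw S hS := by
    have h1 : w.support.tail.length = w.length := by simp
    rw [← h1, ← List.toFinset_card_of_nodup hw.support_nodup]
    refine Finset.card_le_card fun a ha ↦ ?_
    have ha' : a ∈ w.support := List.mem_of_mem_tail (List.mem_toFinset.1 ha)
    obtain ⟨e, he, hae⟩ := (SimpleGraph.Walk.mem_support_iff_exists_mem_edges_of_not_nil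
      hw.not_nil).1 ha'
    exact hS e he (by simpa using hae)
  exists_equiv φ := by
    refine ⟨φ.toEquiv, fun e ↦ ?_⟩
    ext a
    simp only [Sym2.mem_toFinset, Sym2.mem_map, Finset.mem_map_equiv]
    refine ⟨?_, fun h ↦ ⟨_, h, φ.apply_symm_apply a⟩⟩
    rintro ⟨b, hb, rfl⟩
    rwa [show φ.toEquiv.symm (φ b) = b from φ.symm_apply_apply b]

lemma openGraph_siteModel_adj {ω : Set V} {a b : V} :
    ((siteModel G).openGraph ω).Adj a b ↔ G.Adj a b ∧ a ∈ ω ∧ b ∈ ω := by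
  simp [Model.openGraph, siteModel, Set.subset_def]

lemma reachable_siteSubgraph_iff {ω : Set V} {a b : ω} :
    (siteSubgraph G ω).Reachable a b ↔ ((siteModel G).openGraph ω).Reachable a b := by
  constructor
  · refine fun h ↦ h.map ⟨Subtype.val, fun {x y} hxy ↦ ?_⟩
    exact openGraph_siteModel_adj.2 ⟨hxy, x.2, y.2⟩
  · rintro ⟨w⟩
    obtain ⟨a, ha⟩ := a
    obtain ⟨b, hb⟩ := b
    change ((siteModel G).openGraph ω).Walk a b at w
    induction w with
    | nil => rfl
    | cons h p ih =>
      obtain ⟨h1, -, h2⟩ := openGraph_siteModel_adj.1 h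
      refine SimpleGraph.Reachable.trans (SimpleGraph.Adj.reachable ?_) (ih h2 hb)
      exact h1

/-- An infinite cluster of the open graph of site percolation consists of open vertices: closed
vertices are isolated. -/
lemma mem_of_infinite_openGraph_siteModel {ω : Set V} {x : V}
    (hx : {y | ((siteModel G).openGraph ω).Reachable x y}.Infinite) :
    ∀ y, ((siteModel G).openGraph ω).Reachable x y → x ∈ ω ∧ y ∈ ω := by
  have hxω : x ∈ ω := by
    by_contra hxω
    refine hx ((Set.finite_singleton x).subset ?_)
    rintro y ⟨w⟩
    cases w with
    | nil => rfl
    | cons h p => exact absurd (openGraph_siteModel_adj.1 h).2.1 hxω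
  rintro y ⟨w⟩
  refine ⟨hxω, ?_⟩
  cases hw : w.reverse with
  | nil => exact hxω
  | cons h p => exact (openGraph_siteModel_adj.1 h).2.1

lemma infinite_reachable_siteSubgraph {ω : Set V} {x : V} (hxω : x ∈ ω)
    (hx : {y | ((siteModel G).openGraph ω).Reachable x y}.Infinite) :
    {y | (siteSubgraph G ω).Reachable ⟨x, hxω⟩ y}.Infinite := by
  refine Set.Infinite.of_image Subtype.val (hx.mono fun y hy ↦ ?_)
  have hyω := (mem_of_infinite_openGraph_siteModel hx y hy).2
  exact ⟨⟨y, hyω⟩, reachable_siteSubgraph_iff.2 hy, rfl⟩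

/-! ### The lower bound for the uniqueness thresholds -/

/-- The unique infinite cluster in terms of the sets of vertices reachable from given ones. -/
lemma HasUniqueInfiniteCluster.exists_and_forall {W : Type*} {H : SimpleGraph W}
    (h : HasUniqueInfiniteCluster H) :
    (∃ x, {y | H.Reachable x y}.Infinite) ∧ ∀ x y, {z | H.Reachable x z}.Infinite →
      {z | H.Reachable y z}.Infinite → H.Reachable x y := by
  have hsupp : ∀ x, (H.connectedComponentMk x).supp = {y | H.Reachable x y} := fun x ↦ by
    ext y
    rw [SimpleGraph.ConnectedComponent.mem_supp_iff, SimpleGraph.ConnectedComponent.eq]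
    exact SimpleGraph.reachable_comm
  obtain ⟨C, hC, huniq⟩ := h
  refine ⟨?_, fun x y hx hy ↦ SimpleGraph.ConnectedComponent.exact
    ((huniq (H.connectedComponentMk x) ?_).trans (huniq (H.connectedComponentMk y) ?_).symm)⟩
  · induction C using SimpleGraph.ConnectedComponent.ind with
    | _ x => exact ⟨x, hsupp x ▸ hC⟩
  · simpa only [hsupp] using hx
  · simpa only [hsupp] using hy

end Percolation

theorem mainTheorem3 {V : Type*} [Countable V] (G : SimpleGraph V) (hconn : G.Connected)
    (hfin : ∀ v : V, (G.neighborSet v).Finite) (htrans : Percolation.IsTransitive G) (o : V) :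
    min 1 (Percolation.cycleLiminf G o) ≤ Percolation.puBond G ∧
      min 1 (Percolation.cycleLiminf G o) ≤ Percolation.puSite G := by
  refine ⟨le_iInf₂ fun p hp ↦ ?_, le_iInf₂ fun p hp ↦ ?_⟩
  · refine (Percolation.bondModel hfin htrans o).min_one_cycleLiminf_le hconn hfin htrans o ?_ ?_
    · filter_upwards [hp] with ω hω
      rw [Percolation.openGraph_bondModel]
      exact hω.exists_and_forall.1
    · filter_upwards [hp] with ω hω
      rw [Percolation.openGraph_bondModel]
      exact hω.exists_and_forall.2
  · refine (Percolation.siteModel G).min_one_cycleLiminf_le hconn hfin htrans o ?_ ?_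
    · filter_upwards [hp] with ω hω
      obtain ⟨x, hx⟩ := hω.exists_and_forall.1
      refine ⟨x, (hx.image Subtype.val_injective.injOn).mono ?_⟩
      rintro _ ⟨y, hy, rfl⟩
      exact Percolation.reachable_siteSubgraph_iff.1 hy
    · filter_upwards [hp] with ω hω x y hx hy
      have hxω := (Percolation.mem_of_infinite_openGraph_siteModel hx x .rfl).1
      have hyω := (Percolation.mem_of_infinite_openGraph_siteModel hy y .rfl).1
      exact Percolation.reachable_siteSubgraph_iff.1 (hω.exists_and_forall.2 ⟨x, hxω⟩ ⟨y, hyω⟩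
        (Percolation.infinite_reachable_siteSubgraph hxω hx)
        (Percolation.infinite_reachable_siteSubgraph hyω hy))
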